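/- **Setting.** There are $n$ parties $P_1,\dots,P_n$, pairwise connected by authenticated links, with a common clock counting ticks. The network is synchronous: for a known integer $\Delta\ge 1$, a message sent at tick $s$ is delivered, together with its sending tick, at one of the ticks $s+1,\dots,s+\Delta$. Let $V_{\mathrm{in}}$ be a non-empty, at most countable set of inputs and $V_{\mathrm{out}}$ a set of outputs, and let $t_s<n$. An *input configuration* $I$ consists of a set of at least $n-t_s$ (honest) parties together with an input in $V_{\mathrm{in}}$ for each of them; the remaining parties are corrupted. A *validity property* is a map $\mathcal V$ assigning to each input configuration $I$ a set $\mathcal V(I)\subseteq V_{\mathrm{out}}$ of valid outputs. It is *trivial* if $\bigcap_I \mathcal V(I)\neq\emptyset$, the intersection being over all input configurations. A *protocol without cryptographic setup* lets each party be a state machine with an arbitrary state space, which at each tick updates its state from the messages delivered to it and sends a message (or nothing) to each party. Parties may use (i) public randomness drawn from an arbitrary probability space and known to everybody, including the adversary, and (ii) private coins: at each tick each party draws a coin from a countable set, all these coins being independent of each other and of the public randomness, and hidden from the other parties and from the adversary. The adversary is static and computationally unbounded. It knows the public randomness and the messages delivered to the corrupted parties, determines all messages sent by the corrupted parties, and chooses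 the delivery delays, subject to the bound $\Delta$. A party *decides* the first value that it outputs. A protocol is a *$t_s$-secure synchronous Byzantine agreement protocol solving $\mathcal V$* if, for every input configuration $I$ and every adversary strategy controlling the parties that are not honest in $I$: * (probabilistic termination) the probability that some honest party has not decided by tick $T$ tends to $0$ as $T\to\infty$; * (agreement) almost surely, no two honest parties decide different values; * (validity) almost surely, no honest party decides a value outside $\mathcal V(I)$. **Theorem.** Let $n\ge 3$ and $0<t_s<n$, and suppose that $n\le 3t_s$. If there is a $t_s$-secure synchronous Byzantine agreement protocol without cryptographic setup solving a validity property $\mathcal V$, then $\mathcal V$ is trivial. -/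

import Mathlib

open MeasureTheory Filter Topology

universe u v w

noncomputable section

namespace BA

/-- The σ-algebra on `Option α` in which `none` is an isolated point. -/
instance instMeasurableSpaceOption {α : Type*} [m : MeasurableSpace α] :
    MeasurableSpace (Option α) :=
  m.map some

/-! ### Input configurations and validity properties -/

/-- An input configuration for `n` parties of which at most `t` are corrupted: the set of honest
parties (at least `n - t` of them) and the input of each honest party.  The parties outside
`honest` are the corrupted ones. -/
structure InputConfig (n t : ℕ) (Vin : Type v) where
  honest : Finset (Fin n)
  input : {i // i ∈ honest} → Vin
  card_honest : n ≤ honest.card + t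

/-- A validity property maps each input configuration to the set of valid outputs. -/
abbrev ValidityProperty (n t : ℕ) (Vin : Type v) (Vout : Type w) : Type (max v w) :=
  InputConfig n t Vin → Set Vout

/-- A validity property is trivial if some output is valid for all input configurations. -/
def ValidityProperty.IsTrivial {n t : ℕ} {Vin : Type v} {Vout : Type w}
    (V : ValidityProperty n t Vin Vout) : Prop :=
  (⋂ I : InputConfig n t Vin, V I).Nonempty

/-! ### Protocols

Time is counted in ticks of the common clock.  Between any two parties there is an authenticated
link, and a message sent at tick `s` is delivered at one of the ticks `s + 1, …, s + Δ`. -/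

/-- What a party receives at one tick: `x j k` is the message from party `j` that was sent `k + 1`
ticks ago and is delivered now (`none` if there is no such message). -/
abbrev Inbox (n Δ : ℕ) (Msg : Type u) : Type u := Fin n → Fin Δ → Option Msg

/-- A (possibly randomized) protocol without cryptographic setup.  Every party is an interactive
state machine with an arbitrary, possibly infinite, state space.  There are two sources of
randomness:

* `pub`, a sample from an arbitrary probability space, which is available to every party and to the
  adversary (a party is free to ignore any part of it);
* private coins: at tick `r`, party `i` flips a coin with the discrete law `coin i r`.  All private
  coins are independent of each other and of `pub`, and neither the other parties nor the adversary
  see them. -/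
structure Protocol (n Δ : ℕ) (Vin : Type v) (Vout : Type w) where
  State : Type u
  Msg : Type u
  Pub : Type u
  Coin : Type u
  [mState : MeasurableSpace State]
  [mMsg : MeasurableSpace Msg]
  [mPub : MeasurableSpace Pub]
  [countableCoin : Countable Coin]
  /-- The law of the public randomness. -/
  pub : Measure Pub
  [probPub : IsProbabilityMeasure pub]
  /-- The laws of the private coins. -/
  coin : Fin n → ℕ → PMF Coin
  /-- The initial state of a party, from its input and the public randomness. -/
  init : Fin n → Vin → Pub → State
  /-- The next state, from the current state, a fresh private coin and the messages that arrive. -/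
  step : Fin n → State → Coin → Inbox n Δ Msg → State
  /-- `send i s j` is what party `i` in state `s` sends to party `j` (`none`: nothing). -/
  send : Fin n → State → Fin n → Option Msg
  /-- The output of a party in a given state (`none`: no output). -/
  out : Fin n → State → Option Vout
  measurable_init : ∀ i x, Measurable (init i x)
  measurable_step : ∀ i c, Measurable fun p : State × Inbox n Δ Msg => step i p.1 c p.2
  measurable_send : ∀ i j, Measurable fun s => send i s j

attribute [instance] Protocol.mState Protocol.mMsg Protocol.mPub Protocol.countableCoin
  Protocol.probPub

namespace Protocol

variable {n t Δ : ℕ} {Vin : Type v} {Vout : Type w}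

instance (P : Protocol.{u} n Δ Vin Vout) : MeasurableSpace P.Coin := ⊤

/-- A sample of all the randomness: public randomness, and the private coin of each party at each
tick. -/
abbrev Rand (P : Protocol.{u} n Δ Vin Vout) : Type u := P.Pub × (Fin n × ℕ → P.Coin)

/-- The law of the randomness. -/
def law (P : Protocol.{u} n Δ Vin Vout) : Measure P.Rand :=
  P.pub.prod (Measure.infinitePi fun p : Fin n × ℕ => (P.coin p.1 p.2).toMeasure)

/-- A strategy of a static, computationally unbounded adversary that controls the parties outside
`honest` together with the delivery schedule.  It knows the public randomness and what is delivered
to the corrupted parties; it neither sees the private coins of honest parties nor reads the messages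
between honest parties.  A protocol that tolerates stronger (adaptive, eavesdropping, rushing,
randomized) adversaries also tolerates these. -/
structure Adversary (P : Protocol.{u} n Δ Vin Vout) (honest : Finset (Fin n)) where
  State : Type u
  [mState : MeasurableSpace State]
  init : P.Pub → State
  step : State → ({i // i ∉ honest} → Inbox n Δ P.Msg) → State
  /-- `send a i j` is what the corrupted party `i` sends to party `j` (`none`: nothing). -/
  send : State → {i // i ∉ honest} → Fin n → Option P.Msg
  /-- A message that `i` sends to `j` now is delivered after `delay a i j + 1 ≤ Δ` ticks. -/
  delay : State → Fin n → Fin n → Fin Δ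
  measurable_init : Measurable init
  measurable_step :
    Measurable fun p : State × ({i // i ∉ honest} → Inbox n Δ P.Msg) => step p.1 p.2
  measurable_send : ∀ i j, Measurable fun a => send a i j
  measurable_delay : ∀ i j, Measurable fun a => delay a i j

/-- What is put on the links at one tick: `x j i` is the message sent from `j` to `i`, if any, with
its delivery delay. -/
abbrev Traffic (n Δ : ℕ) (Msg : Type u) : Type u := Fin n → Fin n → Option Msg × Fin Δ

/-- The global configuration of an execution at a tick: the states of the honest parties and of the
adversary, and the traffic of all earlier ticks, the latest first. -/
structure Config (P : Protocol.{u} n Δ Vin Vout) {honest : Finset (Fin n)}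
    (A : P.Adversary honest) where
  st : {i // i ∈ honest} → P.State
  adv : A.State
  past : List (Traffic n Δ P.Msg)

variable {P : Protocol.{u} n Δ Vin Vout} {honest : Finset (Fin n)} {A : P.Adversary honest}

/-- The traffic generated in a configuration. -/
def Config.traffic (e : P.Config A) : Traffic n Δ P.Msg := fun j i =>
  (if h : j ∈ honest then P.send j (e.st ⟨j, h⟩) i else A.send e.adv ⟨j, h⟩ i, A.delay e.adv j i)

/-- What is delivered to party `i`, when `log` lists the traffic of all earlier ticks, the latest
first. -/
def inboxOf {Msg : Type u} (log : List (Traffic n Δ Msg)) (i : Fin n) : Inbox n Δ Msg :=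
  fun j k =>
    match log[(k : ℕ)]? with
    | some x => if (x j i).2 = k then (x j i).1 else none
    | none => none

/-- The configuration at tick `r` of the execution with input configuration `I`, adversary `A` and
randomness `R`. -/
def run (P : Protocol.{u} n Δ Vin Vout) (I : InputConfig n t Vin) (A : P.Adversary I.honest)
    (R : P.Rand) : ℕ → P.Config A
  | 0 =>
    { st := fun i => P.init i (I.input i) R.1
      adv := A.init R.1
      past := [] }
  | r + 1 =>
    let e := run P I A R r
    let log := e.traffic :: e.past
    { st := fun i => P.step i (e.st i) (R.2 (i, r)) (inboxOf log i)
      adv := A.step e.adv fun i => inboxOf log i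
      past := log }

/-- The output that honest party `i` shows at tick `r` (`none`: no output). -/
def outAt (P : Protocol.{u} n Δ Vin Vout) (I : InputConfig n t Vin) (A : P.Adversary I.honest)
    (R : P.Rand) (i : {i // i ∈ I.honest}) (r : ℕ) : Option Vout :=
  P.out i ((P.run I A R r).st i)

/-- Honest party `i` decides `y`: its first output is `y`. -/
def Decides (P : Protocol.{u} n Δ Vin Vout) (I : InputConfig n t Vin) (A : P.Adversary I.honest)
    (R : P.Rand) (i : {i // i ∈ I.honest}) (y : Vout) : Prop :=
  ∃ r, P.outAt I A R i r = some y ∧ ∀ s < r, P.outAt I A R i s = none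

/-- As time goes to infinity, the probability that some honest party has not yet decided tends to
`0`. -/
def ProbabilisticTermination (P : Protocol.{u} n Δ Vin Vout) (I : InputConfig n t Vin)
    (A : P.Adversary I.honest) : Prop :=
  Tendsto (fun T : ℕ => P.law {R | ∃ i, ∀ r ≤ T, P.outAt I A R i r = none}) atTop (𝓝 0)

/-- Almost surely, no two honest parties decide different values. -/
def Agreement (P : Protocol.{u} n Δ Vin Vout) (I : InputConfig n t Vin)
    (A : P.Adversary I.honest) : Prop :=
  ∀ᵐ R ∂P.law, ∀ i j y z, P.Decides I A R i y → P.Decides I A R j z → y = z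

/-- Almost surely, no honest party decides a value that is not valid. -/
def Validity (P : Protocol.{u} n Δ Vin Vout) (V : ValidityProperty n t Vin Vout)
    (I : InputConfig n t Vin) (A : P.Adversary I.honest) : Prop :=
  ∀ᵐ R ∂P.law, ∀ i y, P.Decides I A R i y → y ∈ V I

/-- `P` is a `t`-secure synchronous Byzantine agreement protocol solving `V`: for every input
configuration (so, at most `t` corrupted parties) and every adversary, it achieves probabilistic
termination, agreement and validity. -/
def SecurelySolves (P : Protocol.{u} n Δ Vin Vout) (V : ValidityProperty n t Vin Vout) : Prop :=
  ∀ (I : InputConfig n t Vin) (A : P.Adversary I.honest),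
    P.ProbabilisticTermination I A ∧ P.Agreement I A ∧ P.Validity V I A

end Protocol

end BA

end

/-! Split the parties by index modulo `3` into groups, each of at most `t` parties because `n ≤ 3 *
t`, and unroll the triangle of groups into an infinite line of copies. Two adjacent positions of the
line can be the honest parties of a real execution: the third group is corrupted and simulates all
other copies (`CoverEmbedding.run_eq`), which no setup prevents. Adjacent pairs overlap in a
position, so agreement propagates along the line. With inputs `x` on the left half and `x'` on the
right, copies far from the middle behave for `T` ticks as in the fault-free networks with inputs `x`
and `x'`. Hence all fault-free executions reach one decision. It is valid for every `I`, since
corrupted parties may also just follow the protocol.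

Randomness is handled by possibility instead of probability. For fixed public randomness, a finite
coin prefix of positive probability extends to coins with which a given pair decides
(`exists_finCoins_decide`). That decision depends on a longer finite prefix only, so the pairs of a
segment can be treated one after another. The simulated coins `g` are part of the adversary
strategy; only countably many `g` and inputs occur, so one sample `ω` is good for all of them. -/

noncomputable section

namespace BA

namespace Protocol

variable {n t Δ : ℕ} {Vin : Type v} {Vout : Type w}

open scoped Classical

/-! ### Executions on a cover of the network

A cover has a copy of party `i` at every position `q : Q`; the copy of party `j` that it is linked
to sits at position `nb q j`.  All messages take one tick. -/

section Cover

variable {Q : Type} (P : Protocol.{u} n Δ Vin Vout) (nb : Q → Fin n → Q) (inp : Q → Fin n → Vin)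

/-- The state at tick `r` of the copy of party `i` at position `q`, when the copies have the inputs
`inp` and the coins `g`. -/
def coverState (ω : P.Pub) (g : Q → Fin n → ℕ → P.Coin) : ℕ → Q → Fin n → P.State
  | 0, q, i => P.init i (inp q i) ω
  | r + 1, q, i => P.step i (coverState ω g r q i) (g q i r) fun j k =>
      if (k : ℕ) = 0 then P.send j (coverState ω g r (nb q j) j) i else none

theorem coverState_congr {ω : P.Pub} {g g' : Q → Fin n → ℕ → P.Coin} {T : ℕ}
    (h : ∀ q i, ∀ r < T, g q i r = g' q i r) {r : ℕ} (hr : r ≤ T) (q : Q) (i : Fin n) :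
    P.coverState nb inp ω g r q i = P.coverState nb inp ω g' r q i := by
  induction r generalizing q i with
  | zero => rfl
  | succ r ih => simp only [coverState, ih (by omega), h q i r (by omega)]

/-- Party `i`, passing through the states `s`, outputs for the first time at tick `r`, namely
`y`. -/
def FirstOut (i : Fin n) (s : ℕ → P.State) (y : Vout) (r : ℕ) : Prop :=
  P.out i (s r) = some y ∧ ∀ k < r, P.out i (s k) = none

variable {P} in
theorem FirstOut.unique {i : Fin n} {s : ℕ → P.State} {y z : Vout} {r k : ℕ}
    (h : P.FirstOut i s y r) (h' : P.FirstOut i s z k) : y = z := by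
  rcases lt_trichotomy r k with hk | rfl | hk
  · exact absurd (h.1.symm.trans (h'.2 _ hk)) (by simp)
  · exact Option.some_injective _ (h.1.symm.trans h'.1)
  · exact absurd (h'.1.symm.trans (h.2 _ hk)) (by simp)

variable {P} in
theorem FirstOut.congr {i : Fin n} {s s' : ℕ → P.State} {y : Vout} {r : ℕ}
    (h : P.FirstOut i s y r) (hs : ∀ k ≤ r, s k = s' k) : P.FirstOut i s' y r :=
  ⟨hs r le_rfl ▸ h.1, fun k hk => hs k hk.le ▸ h.2 k hk⟩

/-- The coins `g`, except that the copy of each party `i ∈ H` at position `pos i` uses the coins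
`c`. -/
def overrideCoins (H : Finset (Fin n)) (pos : Fin n → Q) (g : Q → Fin n → ℕ → P.Coin)
    (c : Fin n × ℕ → P.Coin) : Q → Fin n → ℕ → P.Coin :=
  fun q i r => if i ∈ H ∧ q = pos i then c (i, r) else g q i r

/-- The adversary that lets the honest parties `i ∈ H` take part in the cover at the positions
`pos i`, and that simulates all other copies with the coins `g`. -/
def coverAdversary (g : Q → Fin n → ℕ → P.Coin) (H : Finset (Fin n)) (pos : Fin n → Q)
    (hΔ : 0 < Δ) : P.Adversary H where
  State := (Q → Fin n → P.State) × ℕ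
  init ω := (fun q i => P.init i (inp q i) ω, 0)
  step a x :=
    (fun q i => P.step i (a.1 q i) (g q i a.2) fun j k =>
      if (k : ℕ) = 0 then
        -- Real messages of honest parties are visible only to corrupted recipients;
        -- `CoverEmbedding.eq_pos` ensures that no other simulated copy that matters needs them.
        if h : i ∉ H ∧ j ∈ H ∧ nb q j = pos j then x ⟨i, h.1⟩ j k
        else P.send j (a.1 (nb q j) j) i
      else none, a.2 + 1)
  send a i j := P.send i (a.1 (nb (pos j) i) i) j
  delay _ _ _ := ⟨0, hΔ⟩
  measurable_init :=
    (measurable_pi_iff.2 fun q => measurable_pi_iff.2 fun i =>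
      P.measurable_init i (inp q i)).prodMk measurable_const
  measurable_step := by
    refine Measurable.prodMk (measurable_pi_iff.2 fun q => measurable_pi_iff.2 fun i => ?_)
      (measurable_from_top.comp (measurable_snd.comp measurable_fst))
    -- `P.measurable_step` is for a fixed coin, so the tick selecting the coin is split off as a
    -- countable coordinate.
    have key : Measurable fun p : ((Q → Fin n → P.State) ×
        ({i // i ∉ H} → Inbox n Δ P.Msg)) × ℕ =>
        P.step i (p.1.1 q i) (g q i p.2) fun j k =>
          if (k : ℕ) = 0 then
            if h : i ∉ H ∧ j ∈ H ∧ nb q j = pos j then p.1.2 ⟨i, h.1⟩ j k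
            else P.send j (p.1.1 (nb q j) j) i
          else none := by
      refine measurable_from_prod_countable_left fun r => ?_
      have hst : ∀ q i, Measurable fun p : (Q → Fin n → P.State) ×
          ({i // i ∉ H} → Inbox n Δ P.Msg) => p.1 q i := fun q i =>
        measurable_pi_iff.1 (measurable_pi_iff.1 measurable_fst q) i
      have hin : Measurable fun (p : (Q → Fin n → P.State) ×
          ({i // i ∉ H} → Inbox n Δ P.Msg)) (j : Fin n) (k : Fin Δ) => if (k : ℕ) = 0 then
            if h : i ∉ H ∧ j ∈ H ∧ nb q j = pos j then p.2 ⟨i, h.1⟩ j k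
            else P.send j (p.1 (nb q j) j) i
          else none := by
        refine measurable_pi_iff.2 fun j => measurable_pi_iff.2 fun k => ?_
        split_ifs with hk h
        · exact measurable_pi_iff.1 (measurable_pi_iff.1
            (measurable_pi_iff.1 measurable_snd (⟨i, h.1⟩ : {i // i ∉ H})) j) k
        · exact (P.measurable_send j i).comp (hst _ _)
        · exact measurable_const
      exact (P.measurable_step i (g q i r)).comp ((hst q i).prodMk hin)
    exact key.comp (g := _) (f := fun p : ((Q → Fin n → P.State) × ℕ) ×
        ({i // i ∉ H} → Inbox n Δ P.Msg) => ((p.1.1, p.2), p.1.2))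
      (((measurable_fst.comp measurable_fst).prodMk measurable_snd).prodMk
        (measurable_snd.comp measurable_fst))
  measurable_send i j := by
    have h : ∀ q (i : Fin n), Measurable fun a : (Q → Fin n → P.State) × ℕ => a.1 q i := fun q i =>
      measurable_pi_iff.1 (measurable_pi_iff.1 measurable_fst q) i
    exact (P.measurable_send i j).comp (h _ i)
  measurable_delay _ _ := measurable_const

theorem inboxOf_cons {Msg : Type u} {x : Traffic n Δ Msg} {l : List (Traffic n Δ Msg)}
    (hx : ∀ j i, ((x j i).2 : ℕ) = 0) (hl : ∀ y ∈ l, ∀ j i, ((y j i).2 : ℕ) = 0) (i j : Fin n)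
    (k : Fin Δ) : inboxOf (x :: l) i j k = if (k : ℕ) = 0 then (x j i).1 else none := by
  unfold inboxOf
  by_cases hk : (k : ℕ) = 0
  · have : (x j i).2 = k := Fin.ext (by rw [hx, hk])
    simp [hk, this]
  · obtain ⟨m, hm⟩ := Nat.exists_eq_succ_of_ne_zero hk
    rw [hm, Nat.succ_eq_add_one, List.getElem?_cons_succ]
    cases h : l[m]? with
    | none => simp
    | some y =>
      have : (y j i).2 ≠ k := fun e => hk (e ▸ hl y (List.mem_of_getElem? h) j i)
      simp [this]

/-- What makes the execution of `H` against `coverAdversary` an execution on the cover: `G` is a set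
of copies that is closed under links, the honest parties are linked to each other, and no other copy
of an honest party in `G` is linked to an honest party. -/
structure CoverEmbedding (G : Q → Fin n → Prop) (H : Finset (Fin n)) (pos : Fin n → Q) : Prop where
  closed : ∀ q i j, G q i → G (nb q j) j
  pos_mem : ∀ i ∈ H, G (pos i) i
  nb_pos : ∀ i ∈ H, ∀ j ∈ H, nb (pos i) j = pos j
  eq_pos : ∀ q, ∀ i ∈ H, ∀ j ∈ H, G q i → nb q j = pos j → q = pos i

-- The adversary's own copies at the honest positions use the wrong coins, so they are excluded from
-- the invariant. They are never consulted: the messages from those positions are taken from the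
-- real traffic.
variable {P nb inp} in
theorem CoverEmbedding.run_eq {G : Q → Fin n → Prop} {I : InputConfig n t Vin} {pos : Fin n → Q}
    (hG : CoverEmbedding nb G I.honest pos) (hI : ∀ i, I.input i = inp (pos i) i) (hΔ : 0 < Δ)
    (g : Q → Fin n → ℕ → P.Coin) (R : P.Rand) (r : ℕ) :
    let e := P.run I (P.coverAdversary nb inp g I.honest pos hΔ) R r
    let s := P.coverState nb inp R.1 (P.overrideCoins I.honest pos g R.2) r
    (∀ i, e.st i = s (pos i) i) ∧
      (∀ q i, G q i → ¬(i ∈ I.honest ∧ q = pos i) → e.adv.1 q i = s q i) ∧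
      e.adv.2 = r ∧ ∀ y ∈ e.past, ∀ j i, ((y j i).2 : ℕ) = 0 := by
  induction r with
  | zero =>
    refine ⟨fun i => ?_, fun q i _ _ => rfl, rfl, by simp [run]⟩
    simp only [run, coverState, hI]
  | succ r ih =>
    obtain ⟨h1, h2, h3, h4⟩ := ih
    set A := P.coverAdversary nb inp g I.honest pos hΔ
    set e := P.run I A R r
    have hd : ∀ j i, ((e.traffic j i).2 : ℕ) = 0 := fun _ _ => rfl
    have hin := inboxOf_cons hd h4
    refine ⟨fun i => ?_, fun q i hq hi => ?_, ?_, ?_⟩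
    · simp only [run]
      rw [coverState, h1, overrideCoins, if_pos ⟨i.2, rfl⟩]
      congr 1
      funext j k
      rw [hin]
      by_cases hk : (k : ℕ) = 0
      · rw [if_pos hk, if_pos hk]
        by_cases hj : j ∈ I.honest
        · simp only [Config.traffic, dif_pos hj, h1]
          rw [hG.nb_pos i i.2 j hj]
        · simp only [Config.traffic, dif_neg hj]
          rw [← h2 _ _ (hG.closed _ _ j (hG.pos_mem i i.2)) (fun h => hj h.1)]
          rfl
      · rw [if_neg hk, if_neg hk]
    · simp only [run]
      rw [coverState, ← h2 q i hq hi, overrideCoins, if_neg hi]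
      change P.step i (e.adv.1 q i) (g q i e.adv.2) _ = _
      rw [h3]
      congr 1
      funext j k
      by_cases hk : (k : ℕ) = 0
      · rw [if_pos hk, if_pos hk]
        by_cases hj : j ∈ I.honest ∧ nb q j = pos j
        · have hi' : i ∉ I.honest := fun h => hi ⟨h, hG.eq_pos q i h j hj.1 hq hj.2⟩
          rw [dif_pos ⟨hi', hj⟩]
          refine (hin i j k).trans ?_
          rw [if_pos hk]
          simp only [Config.traffic, dif_pos hj.1, h1]
          rw [hj.2]
        · rw [dif_neg (fun h => hj h.2), h2 _ _ (hG.closed q i j hq) hj]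
      · rw [if_neg hk, if_neg hk]
    · change e.adv.2 + 1 = r + 1
      rw [h3]
    · intro y hy
      simp only [run, List.mem_cons] at hy
      rcases hy with rfl | hy
      · exact hd
      · exact h4 y hy

end Cover

/-! ### Passing from probability to possibility -/

theorem SecurelySolves.ae_decides {P : Protocol.{u} n Δ Vin Vout}
    {V : ValidityProperty n t Vin Vout} (hP : P.SecurelySolves V) (htn : t < n)
    (I : InputConfig n t Vin) (A : P.Adversary I.honest) :
    ∀ᵐ R ∂P.law, ∃ y ∈ V I, ∀ i, P.Decides I A R i y := by
  obtain ⟨hT, hA, hV⟩ := hP I A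
  have hT' : ∀ᵐ R ∂P.law, ∀ i, ∃ r, P.outAt I A R i r ≠ none := by
    -- Never deciding implies not having decided by `T`, for every `T`.
    refine le_antisymm (ge_of_tendsto' hT fun T => measure_mono fun R hR => ?_) zero_le
    simp only [Set.mem_compl_iff, Set.mem_ofPred_eq, not_forall, not_exists, not_not] at hR
    obtain ⟨i, hi⟩ := hR
    exact ⟨i, fun r _ => hi r⟩
  filter_upwards [hT', hA, hV] with R h1 h2 h3
  have hD : ∀ i, ∃ y, P.Decides I A R i y := fun i => by
    obtain ⟨y, hy⟩ := Option.ne_none_iff_exists'.1 (Nat.find_spec (h1 i))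
    exact ⟨y, Nat.find (h1 i), hy, fun s hs => not_not.1 (Nat.find_min (h1 i) hs)⟩
  have : I.honest.Nonempty := Finset.card_pos.1 (by have := I.card_honest; omega)
  obtain ⟨i₀, hi₀⟩ := this
  obtain ⟨y, hy⟩ := hD ⟨i₀, hi₀⟩
  refine ⟨y, h3 _ _ hy, fun i => ?_⟩
  obtain ⟨z, hz⟩ := hD i
  rwa [h2 _ _ _ _ hy hz]

/-! ### Coin sequences of positive probability -/

section Coins

variable (P : Protocol.{u} n Δ Vin Vout)

instance : DiscreteMeasurableSpace P.Coin := ⟨fun _ => trivial⟩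

/-- The law of the private coins. -/
abbrev coinLaw : Measure (Fin n × ℕ → P.Coin) :=
  Measure.infinitePi fun p : Fin n × ℕ => (P.coin p.1 p.2).toMeasure

/-- Some coins of positive probability. -/
def someCoin (i : Fin n) (r : ℕ) : P.Coin := (P.coin i r).support_nonempty.some

theorem someCoin_mem (i : Fin n) (r : ℕ) : P.someCoin i r ∈ (P.coin i r).support :=
  (P.coin i r).support_nonempty.some_mem

variable {P} in
/-- Every finite prefix of coins of positive probability extends to coins with a given property that
holds almost surely. -/
theorem exists_coins_of_ae {Φ : (Fin n × ℕ → P.Coin) → Prop} (hΦ : ∀ᵐ c ∂P.coinLaw, Φ c)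
    {c₀ : Fin n × ℕ → P.Coin} (h₀ : ∀ p, c₀ p ∈ (P.coin p.1 p.2).support) (T : ℕ) :
    ∃ c, Φ c ∧ (∀ p, c p ∈ (P.coin p.1 p.2).support) ∧ ∀ i, ∀ r < T, c (i, r) = c₀ (i, r) := by
  have hs : ∀ᵐ c ∂P.coinLaw, ∀ p, c p ∈ (P.coin p.1 p.2).support := by
    refine ae_all_iff.2 fun p => ?_
    have h : ∀ᵐ x ∂(P.coin p.1 p.2).toMeasure, x ∈ (P.coin p.1 p.2).support := by
      rw [ae_iff, PMF.toMeasure_apply_eq_zero_iff _ .of_discrete]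
      exact Set.disjoint_left.2 fun x hx hx' => hx' hx
    exact (measurePreserving_eval_infinitePi
      (fun p : Fin n × ℕ => (P.coin p.1 p.2).toMeasure) p).quasiMeasurePreserving.ae h
  let S : Finset (Fin n × ℕ) := Finset.univ ×ˢ Finset.range T
  -- A prefix fixes finitely many coins, so its cylinder has positive measure and meets every almost
  -- sure event.
  have hpos : P.coinLaw (Set.pi (S : Set (Fin n × ℕ)) fun p => {c₀ p}) ≠ 0 := by
    rw [Measure.infinitePi_pi _ fun _ _ => .of_discrete]
    refine Finset.prod_ne_zero_iff.2 fun p _ => ?_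
    rw [PMF.toMeasure_apply_singleton _ _ .of_discrete]
    exact h₀ p
  have : ∃ c ∈ Set.pi (S : Set (Fin n × ℕ)) fun p => {c₀ p}, Φ c ∧
      ∀ p, c p ∈ (P.coin p.1 p.2).support := by
    by_contra hcon
    push Not at hcon
    refine hpos (measure_mono_null (fun c hc => ?_) (ae_iff.1 (hΦ.and hs)))
    rintro ⟨h1, h2⟩
    obtain ⟨p, hp⟩ := hcon c hc h1
    exact hp (h2 p)
  obtain ⟨c, hc, h1, h2⟩ := this
  exact ⟨c, h1, h2, fun i r hr => hc (i, r) (by simp [S, hr])⟩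

/-- The coins of the copies in a cover that have positive probability and differ from `someCoin`
only finitely often. -/
def FinCoins (Q : Type) : Set (Q → Fin n → ℕ → P.Coin) :=
  {g | (∀ q i r, g q i r ∈ (P.coin i r).support) ∧
    {x : Q × Fin n × ℕ | g x.1 x.2.1 x.2.2 ≠ P.someCoin x.2.1 x.2.2}.Finite}

/-- The exceptional null set of public randomness depends on `g`; countability allows a single null
set for all `g`. -/
theorem countable_finCoins (Q : Type) [Countable Q] : (P.FinCoins Q).Countable := by
  let F : (S : Finset (Q × Fin n × ℕ)) → (S → P.Coin) → Q → Fin n → ℕ → P.Coin :=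
    fun S f q i r => if h : (q, i, r) ∈ S then f ⟨_, h⟩ else P.someCoin i r
  refine (Set.countable_iUnion fun S => Set.countable_range (F S)).mono fun g hg => ?_
  refine Set.mem_iUnion.2 ⟨hg.2.toFinset, fun x => g x.1.1 x.1.2.1 x.1.2.2, ?_⟩
  funext q i r
  by_cases h : g q i r = P.someCoin i r <;> simp [F, h]

theorem someCoin_mem_finCoins (Q : Type) : (fun (_ : Q) i r => P.someCoin i r) ∈ P.FinCoins Q :=
  ⟨fun _ i r => P.someCoin_mem i r, by simp⟩

variable {P} in
theorem FinCoins.of_finite_ne {Q : Type} {g g' : Q → Fin n → ℕ → P.Coin} (hg : g ∈ P.FinCoins Q)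
    (hs : ∀ q i r, g' q i r ∈ (P.coin i r).support) {S : Set (Q × Fin n × ℕ)} (hS : S.Finite)
    (h : ∀ q i r, g' q i r ≠ g q i r → (q, i, r) ∈ S) : g' ∈ P.FinCoins Q := by
  refine ⟨hs, (hS.union hg.2).subset fun ⟨q, i, r⟩ hx => ?_⟩
  by_cases e : g' q i r = g q i r
  · exact Or.inr (by simpa [← e] using hx)
  · exact Or.inl (h q i r e)

end Coins

/-! ### Extending coin prefixes until a decision -/

section Extend

variable {Q : Type} {P : Protocol.{u} n Δ Vin Vout} {nb : Q → Fin n → Q} {inp : Q → Fin n → Vin}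
  {V : ValidityProperty n t Vin Vout}

variable (P nb inp V) in
/-- For the public randomness `ω`, the parties that are honest in `I` almost surely decide on a
common valid value when they sit in the cover at the positions `pos` and all other copies use the
coins `g`. -/
def CoverSecure (I : InputConfig n t Vin) (pos : Fin n → Q) (g : Q → Fin n → ℕ → P.Coin)
    (ω : P.Pub) : Prop :=
  ∀ᵐ c ∂P.coinLaw, ∃ y ∈ V I, ∀ i ∈ I.honest, ∃ r, P.FirstOut i
    (fun k => P.coverState nb inp ω (P.overrideCoins I.honest pos g c) k (pos i) i) y r

theorem SecurelySolves.ae_coverSecure (hP : P.SecurelySolves V) (htn : t < n) (hΔ : 0 < Δ)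
    {G : Q → Fin n → Prop} {I : InputConfig n t Vin} {pos : Fin n → Q}
    (hG : CoverEmbedding nb G I.honest pos) (hI : ∀ i, I.input i = inp (pos i) i)
    (g : Q → Fin n → ℕ → P.Coin) : ∀ᵐ ω ∂P.pub, P.CoverSecure nb inp V I pos g ω := by
  have h := hP.ae_decides htn I (P.coverAdversary nb inp g I.honest pos hΔ)
  filter_upwards [Measure.ae_ae_of_ae_prod h] with ω hω
  filter_upwards [hω] with c hc
  obtain ⟨y, hy, hD⟩ := hc
  refine ⟨y, hy, fun i hi => ?_⟩
  obtain ⟨r, hr⟩ := hD ⟨i, hi⟩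
  refine ⟨r, FirstOut.congr (s := fun k => (P.run I (P.coverAdversary nb inp g I.honest pos hΔ)
    (ω, c) k).st ⟨i, hi⟩) hr fun k _ => ?_⟩
  exact (hG.run_eq hI hΔ g (ω, c) k).1 ⟨i, hi⟩

/-- Any finite prefix of an execution on the cover has a continuation in which the honest parties
of `I` decide on a common valid value. -/
theorem exists_finCoins_decide {I : InputConfig n t Vin} {pos : Fin n → Q} {ω : P.Pub}
    {g : Q → Fin n → ℕ → P.Coin} (hg : g ∈ P.FinCoins Q)
    (h : P.CoverSecure nb inp V I pos g ω) (T : ℕ) :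
    ∃ g' ∈ P.FinCoins Q, (∀ q i, ∀ r < T, g' q i r = g q i r) ∧ ∃ y ∈ V I, ∃ T', T ≤ T' ∧
      ∀ i ∈ I.honest, ∃ r ≤ T', P.FirstOut i (fun k => P.coverState nb inp ω g' k (pos i) i) y r := by
  obtain ⟨c, ⟨y, hy, hD⟩, hc, hcT⟩ := exists_coins_of_ae h
    (c₀ := fun p => g (pos p.1) p.1 p.2) (fun p => hg.1 _ _ _) T
  choose! r hr using hD
  let T' := max T (I.honest.sup r)
  have hrT : ∀ i ∈ I.honest, r i ≤ T' := fun i hi =>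
    (Finset.le_sup (f := r) hi).trans (le_max_right _ _)
  -- Returning to `g` from tick `T'` on keeps the change finite; states up to tick `T'` use only
  -- earlier coins.
  let g' : Q → Fin n → ℕ → P.Coin := fun q i k =>
    if k < T' then P.overrideCoins I.honest pos g c q i k else g q i k
  refine ⟨g', ?_, fun q i k hk => ?_, y, hy, T', le_max_left _ _, fun i hi => ⟨r i, hrT i hi, ?_⟩⟩
  · refine FinCoins.of_finite_ne hg (fun q i k => ?_)
      (S := (fun x : Fin n × ℕ => (pos x.1, x.1, x.2)) '' (Set.univ ×ˢ Set.Iio T'))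
      ((Set.finite_univ.prod (Set.finite_Iio T')).image _) fun q i k hne => ?_
    · simp only [g', overrideCoins]
      split_ifs
      exacts [hc (i, k), hg.1 _ _ _, hg.1 _ _ _]
    · simp only [g', overrideCoins] at hne
      split_ifs at hne with h1 h2
      · exact ⟨(i, k), ⟨trivial, h1⟩, by simp [h2.2]⟩
      all_goals exact absurd rfl hne
  · simp only [g', overrideCoins]
    split_ifs with h1 h2
    · rw [hcT i k hk, h2.2]
    all_goals rfl
  · refine (hr i hi).congr fun k hk => P.coverState_congr nb inp (T := T') (fun q j m hm => ?_)
      (hk.trans (hrT i hi)) _ _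
    simp only [g', if_pos hm]

end Extend

/-! ### The line

The parties are split into three groups by their index modulo `3`.  Position `q : ℤ` of the line
holds copies of the parties with index `q` modulo `3`, which are linked to the copies at the
positions `q - 1`, `q` and `q + 1`. -/

section Line

/-- The first position from `p` on that holds a copy of party `i`. -/
def linePos (p : ℤ) (i : Fin n) : ℤ := p + ((i : ℕ) - p) % 3

/-- The position of the copy of party `j` that is linked to the copies at position `q`. -/
def lineNb (q : ℤ) (j : Fin n) : ℤ := linePos (q - 1) j

/-- The parties with copies at the positions `p` and `p + 1`. -/
def lineHonest (n : ℕ) (p : ℤ) : Finset (Fin n) :=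
  Finset.univ.filter fun i => ((i : ℕ) - p) % 3 ≠ 2

theorem mem_lineHonest {p : ℤ} {i : Fin n} : i ∈ lineHonest n p ↔ ((i : ℕ) - p) % 3 ≠ 2 := by
  simp [lineHonest]

/-- Division by `3` maps the omitted residue class injectively into `{0, …, t - 1}`. -/
theorem le_card_lineHonest (hn : n ≤ 3 * t) (p : ℤ) : n ≤ (lineHonest n p).card + t := by
  have h : (Finset.univ.filter fun i : Fin n => ¬ ((i : ℕ) - p) % 3 ≠ 2).card ≤ t := by
    rw [← Finset.card_range t]
    refine Finset.card_le_card_of_injOn (fun i => (i : ℕ) / 3) (fun i _ => ?_) fun i hi j hj h => ?_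
    · simp only [Finset.coe_range, Set.mem_Iio]
      omega
    · simp only [Finset.coe_filter, Finset.mem_univ, true_and, Set.mem_ofPred_eq] at hi hj h
      exact Fin.ext (by omega)
  have := Finset.card_filter_add_card_filter_not (s := (Finset.univ : Finset (Fin n)))
    fun i => ((i : ℕ) - p) % 3 ≠ 2
  simp only [Finset.card_univ, Fintype.card_fin] at this
  unfold lineHonest
  omega

/-- The inputs `x` on the left half of the line and `x'` on the right half. -/
def lineInput (x x' : Fin n → Vin) (q : ℤ) (i : Fin n) : Vin := if q < 0 then x i else x' i

/-- The input configuration in which the copies at the positions `p` and `p + 1` are honest. -/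
def lineConfig (hn : n ≤ 3 * t) (inp : ℤ → Fin n → Vin) (p : ℤ) : InputConfig n t Vin where
  honest := lineHonest n p
  input i := inp (linePos p i.1) i.1
  card_honest := le_card_lineHonest hn p

/-- Copies linked to position `p` or `p + 1` lie between `p - 1` and `p + 2`, and the two outer
positions hold copies of the corrupted group. -/
theorem coverEmbedding_line (p : ℤ) :
    CoverEmbedding lineNb (fun q i => (q - (i : ℕ)) % 3 = 0) (lineHonest n p) (linePos p) where
  closed q i j _ := by simp only [lineNb, linePos]; omega
  pos_mem i _ := by simp only [linePos]; omega
  nb_pos i hi j hj := by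
    rw [mem_lineHonest] at hi hj
    simp only [lineNb, linePos]
    omega
  eq_pos q i hi j hj h h' := by
    rw [mem_lineHonest] at hi hj
    simp only [lineNb, linePos] at h h' ⊢
    omega

variable {P : Protocol.{u} n Δ Vin Vout} {V : ValidityProperty n t Vin Vout}

/-- Any finite prefix of an execution on the line has a continuation in which all copies in a given
segment decide on the same value. -/
theorem exists_finCoins_decide_line (hn3 : 3 ≤ n) (hn : n ≤ 3 * t) {inp : ℤ → Fin n → Vin}
    {ω : P.Pub} (h : ∀ p, ∀ g ∈ P.FinCoins ℤ,
      P.CoverSecure lineNb inp V (lineConfig hn inp p) (linePos p) g ω)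
    {g : ℤ → Fin n → ℕ → P.Coin} (hg : g ∈ P.FinCoins ℤ) (T : ℕ) (p : ℤ) (m : ℕ) :
    ∃ g' ∈ P.FinCoins ℤ, (∀ q i, ∀ r < T, g' q i r = g q i r) ∧ ∃ y T', T ≤ T' ∧
      ∀ q, p ≤ q → q ≤ p + m → ∀ i ∈ lineHonest n q, ∃ r ≤ T',
        P.FirstOut i (fun k => P.coverState lineNb inp ω g' k (linePos q i) i) y r := by
  induction m with
  | zero =>
    obtain ⟨g', hg', hgT, y, -, T', hT', hD⟩ := exists_finCoins_decide hg (h p g hg) T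
    refine ⟨g', hg', hgT, y, T', hT', fun q h1 h2 => ?_⟩
    obtain rfl : q = p := by push_cast at h2; omega
    exact hD
  | succ m ih =>
    obtain ⟨g₁, hg₁, hgT₁, y, T₁, hT₁, hD₁⟩ := ih
    obtain ⟨g₂, hg₂, hgT₂, z, -, T₂, hT₂, hD₂⟩ :=
      exists_finCoins_decide hg₁ (h (p + m + 1) g₁ hg₁) T₁
    have hD₁' : ∀ q, p ≤ q → q ≤ p + m → ∀ i ∈ lineHonest n q, ∃ r ≤ T₁,
        P.FirstOut i (fun k => P.coverState lineNb inp ω g₂ k (linePos q i) i) y r := by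
      intro q h1 h2 i hi
      obtain ⟨r, hr, hrD⟩ := hD₁ q h1 h2 i hi
      exact ⟨r, hr, hrD.congr fun k hk => P.coverState_congr lineNb inp (T := T₁)
        (fun q i r hr => (hgT₂ q i r hr).symm) (hk.trans hr) _ _⟩
    have hyz : y = z := by
      -- A copy at the position shared by the last two pairs; it exists because `3 ≤ n`.
      let i : Fin n := ⟨((p + m + 1) % 3).toNat, by omega⟩
      have hi : ((i : ℕ) : ℤ) = (p + m + 1) % 3 := by simp only [i]; omega
      obtain ⟨r, -, hr⟩ := hD₁' (p + m) (by omega) le_rfl i (mem_lineHonest.2 (by omega))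
      obtain ⟨r', -, hr'⟩ := hD₂ i (mem_lineHonest.2 (by omega))
      have e : linePos (p + m) i = linePos (p + m + 1) i := by simp only [linePos]; omega
      rw [e] at hr
      exact hr.unique hr'
    refine ⟨g₂, hg₂, fun q i r hr => ?_, y, T₂, hT₁.trans hT₂, fun q h1 h2 i hi => ?_⟩
    · rw [hgT₂ q i r (hr.trans_le hT₁), hgT₁ q i r hr]
    · by_cases hq : q ≤ p + m
      · obtain ⟨r, hr, hrD⟩ := hD₁' q h1 hq i hi
        exact ⟨r, hr.trans hT₂, hrD⟩
      · obtain rfl : q = p + m + 1 := by push_cast at h2; omega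
        rw [hyz]
        exact hD₂ i hi

/-- Copies in the line that are far from any irregularity do not notice that they are not in the
network itself. -/
theorem coverState_line_eq {inp : ℤ → Fin n → Vin} {x : Fin n → Vin} {ω : P.Pub}
    {g : ℤ → Fin n → ℕ → P.Coin} {c : Unit → Fin n → ℕ → P.Coin} {a b : ℤ} {T : ℕ}
    (hx : ∀ q, a ≤ q → q ≤ b → ∀ i, inp q i = x i)
    (hc : ∀ q, a ≤ q → q ≤ b → ∀ i, ∀ r < T, g q i r = c () i r) {r : ℕ} (hr : r ≤ T) {q : ℤ}
    (ha : a + r ≤ q) (hb : q + r ≤ b) (i : Fin n) :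
    P.coverState lineNb inp ω g r q i = P.coverState (fun _ _ => ()) (fun _ => x) ω c r () i := by
  induction r generalizing q i with
  | zero => simp only [coverState]; rw [hx q (by simpa using ha) (by simpa using hb)]
  | succ r ih =>
    push_cast at ha hb
    -- Information travels at most one position per tick.
    have h : ∀ j : Fin n, q - 1 ≤ lineNb q j ∧ lineNb q j ≤ q + 1 := fun j => by
      simp only [lineNb, linePos]; omega
    simp only [coverState]
    rw [ih (by omega) (by omega) (by omega), hc q (by omega) (by omega) i r (by omega)]
    congr 1
    funext j k
    rw [ih (by omega) (by have := h j; omega) (by have := h j; omega)]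

/-- Whatever the inputs and the coins, fault-free executions lead to the same decision. -/
theorem eq_of_firstOut_unit (hn3 : 3 ≤ n) (hn : n ≤ 3 * t) {x x' : Fin n → Vin} {ω : P.Pub}
    (h : ∀ p, ∀ g ∈ P.FinCoins ℤ, P.CoverSecure lineNb (lineInput x x') V
      (lineConfig hn (lineInput x x') p) (linePos p) g ω)
    {c c' : Unit → Fin n → ℕ → P.Coin} (hc : c ∈ P.FinCoins Unit) (hc' : c' ∈ P.FinCoins Unit)
    {i i' : Fin n} {y y' : Vout} {r r' : ℕ}
    (hy : P.FirstOut i (fun k => P.coverState (fun _ _ => ()) (fun _ => x) ω c k () i) y r)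
    (hy' : P.FirstOut i' (fun k => P.coverState (fun _ _ => ()) (fun _ => x') ω c' k () i') y' r') :
    y = y' := by
  let T : ℕ := max r r'
  have hrT : r ≤ T := le_max_left _ _
  have hrT' : r' ≤ T := le_max_right _ _
  -- The window contains everything within distance `T` of `p ≥ -T - 3` and `p' ≤ T + 2` below, and
  -- is finite so that `g ∈ P.FinCoins ℤ`.
  let N : ℤ := 2 * T + 4
  let g : ℤ → Fin n → ℕ → P.Coin := fun q i k =>
    if k < T ∧ -N ≤ q ∧ q ≤ N then (if q < 0 then c () i k else c' () i k) else P.someCoin i k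
  have hg : g ∈ P.FinCoins ℤ := by
    refine FinCoins.of_finite_ne (P.someCoin_mem_finCoins ℤ) (fun q i k => ?_)
      (S := Set.Icc (-N) N ×ˢ (Set.univ ×ˢ Set.Iio T))
      ((Set.finite_Icc _ _).prod (Set.finite_univ.prod (Set.finite_Iio T))) fun q i k hne => ?_
    · simp only [g]
      split_ifs
      exacts [hc.1 _ _ _, hc'.1 _ _ _, P.someCoin_mem i k]
    · by_contra hcon
      refine hne (if_neg fun hk => hcon ?_)
      exact ⟨⟨hk.2.1, hk.2.2⟩, trivial, hk.1⟩
  -- Copies of `i` and `i'` whose `T`-neighbourhoods stay in the left and in the right half.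
  let p : ℤ := linePos (-T - 3) i
  let p' : ℤ := linePos T i'
  have hp : -T - 3 ≤ p ∧ p ≤ -T - 1 ∧ (p - (i : ℕ)) % 3 = 0 := by
    simp only [p, linePos]; omega
  have hp' : T ≤ p' ∧ p' ≤ T + 2 ∧ (p' - (i' : ℕ)) % 3 = 0 := by
    simp only [p', linePos]; omega
  obtain ⟨g', -, hgT, z, T', -, hD⟩ :=
    exists_finCoins_decide_line hn3 hn h hg T p (p' - p).toNat
  obtain ⟨k, -, hk⟩ := hD p le_rfl (by omega) i (mem_lineHonest.2 (by omega))
  obtain ⟨k', -, hk'⟩ := hD p' (by omega) (by omega) i' (mem_lineHonest.2 (by omega))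
  rw [show linePos p i = p by simp only [linePos]; omega] at hk
  rw [show linePos p' i' = p' by simp only [linePos]; omega] at hk'
  have e : y = z := by
    refine (hy.congr fun m hm => ?_).unique hk
    refine (coverState_line_eq (a := -N) (b := -1) (T := T) (fun q _ hq i => ?_)
      (fun q hq hq' i l hl => ?_) (hm.trans hrT) (by omega) (by omega) i).symm
    · simp only [lineInput]; rw [if_pos (by omega)]
    · rw [hgT q i l hl]
      simp only [g]
      rw [if_pos ⟨hl, hq, by omega⟩, if_pos (by omega)]
  have e' : y' = z := by
    refine (hy'.congr fun m hm => ?_).unique hk'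
    refine (coverState_line_eq (a := 0) (b := N) (T := T) (fun q hq _ i => ?_)
      (fun q hq hq' i l hl => ?_) (hm.trans hrT') (by omega) (by omega) i').symm
    · simp only [lineInput]; rw [if_neg (by omega)]
    · rw [hgT q i l hl]
      simp only [g]
      rw [if_pos ⟨hl, by omega, hq'⟩, if_neg (by omega)]
  rw [e, e']

end Line

/-- The network covers itself; here `coverAdversary` makes the corrupted parties follow the
protocol. -/
theorem coverEmbedding_unit (H : Finset (Fin n)) :
    CoverEmbedding (fun (_ : Unit) (_ : Fin n) => ()) (fun _ _ => True) H fun _ => () where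
  closed _ _ _ _ := trivial
  pos_mem _ _ := trivial
  nb_pos _ _ _ _ := rfl
  eq_pos _ _ _ _ _ _ _ := rfl

end Protocol

/-! ### Countably many input configurations, and the conclusion -/

instance {n t : ℕ} {Vin : Type v} [Countable Vin] : Countable (InputConfig n t Vin) := by
  refine Function.Injective.countable
    (f := fun I : InputConfig n t Vin =>
      (⟨I.honest, I.input⟩ : Σ H : Finset (Fin n), {i // i ∈ H} → Vin)) ?_
  rintro ⟨H, x, h⟩ ⟨H', x', h'⟩ e
  simp only [Sigma.mk.injEq] at e
  obtain ⟨rfl, e⟩ := e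
  cases e
  rfl

/-- Inputs of all parties that extend those of an input configuration. -/
def InputConfig.extend {n t : ℕ} {Vin : Type v} [Nonempty Vin] (I : InputConfig n t Vin)
    (i : Fin n) : Vin :=
  open scoped Classical in if h : i ∈ I.honest then I.input ⟨i, h⟩ else Classical.arbitrary Vin

end BA

end

open BA BA.Protocol in
theorem mainTheorem3 {n t Δ : ℕ} (hn3 : 3 ≤ n) (htn : t < n) (ht : 0 < t) (hn : n ≤ 3 * t)
    (hΔ : 0 < Δ) {Vin : Type v} {Vout : Type w} [Countable Vin] [Nonempty Vin]
    (V : BA.ValidityProperty n t Vin Vout)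
    (hV : ∃ P : BA.Protocol.{u} n Δ Vin Vout, P.SecurelySolves V) :
    V.IsTrivial := by
  obtain ⟨P, hP⟩ := hV
  have h1 : ∀ᵐ ω ∂P.pub, ∀ x x' : Fin n → Vin, ∀ p, ∀ g ∈ P.FinCoins ℤ,
      P.CoverSecure lineNb (lineInput x x') V (lineConfig hn (lineInput x x') p) (linePos p) g ω :=
    ae_all_iff.2 fun x => ae_all_iff.2 fun x' => ae_all_iff.2 fun p =>
      (ae_ball_iff (P.countable_finCoins ℤ)).2 fun g _ =>
        hP.ae_coverSecure htn hΔ (coverEmbedding_line p) (fun _ => rfl) g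
  have h2 : ∀ᵐ ω ∂P.pub, ∀ I : InputConfig n t Vin, P.CoverSecure (fun _ _ => ())
      (fun _ => I.extend) V I (fun _ => ()) (fun (_ : Unit) i r => P.someCoin i r) ω :=
    ae_all_iff.2 fun I => hP.ae_coverSecure htn hΔ (coverEmbedding_unit I.honest)
      (fun i => by simp [InputConfig.extend]) _
  obtain ⟨ω, hω1, hω2⟩ := (h1.and h2).exists
  have h3 : ∀ I : InputConfig n t Vin, ∃ y ∈ V I, ∃ c ∈ P.FinCoins Unit, ∃ i r, P.FirstOut i
      (fun k => P.coverState (fun _ _ => ()) (fun _ => I.extend) ω c k () i) y r := by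
    intro I
    obtain ⟨c, hc, -, y, hy, T, -, hD⟩ :=
      exists_finCoins_decide (P.someCoin_mem_finCoins Unit) (hω2 I) 0
    obtain ⟨i, hi⟩ : I.honest.Nonempty := Finset.card_pos.1 (by have := I.card_honest; omega)
    obtain ⟨r, -, hr⟩ := hD i hi
    exact ⟨y, hy, c, hc, i, r, hr⟩
  choose y hyV c hc i r hD using h3
  -- Any reference configuration would do, as all of them lead to the same decision.
  let I₀ : InputConfig n t Vin := ⟨Finset.univ, fun _ => Classical.arbitrary Vin, by simp⟩
  refine ⟨y I₀, Set.mem_iInter.2 fun I => ?_⟩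
  rw [eq_of_firstOut_unit hn3 hn (hω1 _ _) (hc I₀) (hc I) (hD I₀) (hD I)]
  exact hyV I
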